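/- Let $d\ge 2$ be an integer. Let $2_*:=\frac{2d}{d+2}$ if $d\ge 3$, and let $2_*\in(1,2)$ be an arbitrary fixed number if $d=2$. Let $\lambda>0$ and let $q\in(d/2,\infty)$ with $q\ge 2_*$. Let $U\subset\mathbb R^d$ be a bounded open set, with Lebesgue measure $|U|$, and assume (A): $A=(a_{ij})_{1\le i,j\le d}$ is a (possibly non-symmetric) matrix of functions in $L^\infty(U)$ such that, for some constant $\Lambda>0$, $$\langle A(x)\xi,\xi\rangle\ge\lambda\|\xi\|^2,\qquad \max_{1\le i,j\le d}|a_{ij}(x)|\le\Lambda\qquad\text{for all }x\in U,\ \xi\in\mathbb R^d;$$ $B\in L^2(U,\mathbb R^d)$ satisfies $\operatorname{div}B\le 0$ weakly in $U$, that is, $\int_U\langle B,\nabla\varphi\rangle\,dx\ge 0$ for all $\varphi\in C_0^\infty(U)$ with $\varphi\ge 0$; $\alpha\in[0,\infty)$; and $c\in L^{2_*}(U)$ with $c\ge 0$. Let $f\in L^q(U)$ and $F\in L^{2q}(U,\mathbb R^d)$, where $\|F\|_{L^{2q}(U)}$ is the $L^{2q}(U)$-norm of the Euclidean length $\|F\|$.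 Let $H^{1,2}_0(U)$ be the closure of $C_0^\infty(U)$ in the Sobolev space $H^{1,2}(U)$. There is a constant $C_2>0$, depending only on $\lambda$, $d$, $q$ and $|U|$, such that the following hold. (i) If $u\in H^{1,2}_0(U)\cap L^\infty(U)$ is a weak solution of $-\operatorname{div}(A\nabla u)+\langle B,\nabla u\rangle+(c+\alpha)u=f-\operatorname{div}F$ in $U$, $u=0$ on $\partial U$, that is, $$\int_U\langle A\nabla u,\nabla\varphi\rangle+\big(\langle B,\nabla u\rangle+(c+\alpha)u\big)\varphi\,dx=\int_U f\varphi+\langle F,\nabla\varphi\rangle\,dx\qquad\text{for all }\varphi\in C_0^\infty(U),$$ where both integrals are well defined in $\mathbb R$, then $$\|u\|_{L^\infty(U)}\le C_2\big(\|f\|_{L^q(U)}+\|F\|_{L^{2q}(U)}\big).$$ (ii) If $w\in H^{1,2}_0(U)\cap L^\infty(U)$ is a weak solution of the dual problem $-\operatorname{div}(A\nabla w+wB)+(c+\alpha)w=f-\operatorname{div}F$ in $U$, $w=0$ on $\partial U$, that is, $$\int_U\langle A\nabla w+wB,\nabla\varphi\rangle+(c+\alpha)w\varphi\,dx=\int_U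 f\varphi+\langle F,\nabla\varphi\rangle\,dx\qquad\text{for all }\varphi\in C_0^\infty(U),$$ where both integrals are well defined in $\mathbb R$, then $$\|w\|_{L^\infty(U)}\le C_2\big(\|f\|_{L^q(U)}+\|F\|_{L^{2q}(U)}\big).$$ -/

import Mathlib

open MeasureTheory
open scoped ENNReal NNReal ContDiff

/-- `C_0^∞(U)`: smooth functions with compact support contained in `U`, extended by zero. -/
structure IsTestFunction {d : ℕ} (U : Set (EuclideanSpace ℝ (Fin d)))
    (φ : EuclideanSpace ℝ (Fin d) → ℝ) : Prop where
  smooth : ContDiff ℝ ∞ φ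
  compact : HasCompactSupport φ
  support_subset : tsupport φ ⊆ U

/-- `G = (∂₁ u, …, ∂_d u)` is the weak gradient of `u` on `U`. -/
structure HasWeakGradient {d : ℕ} (U : Set (EuclideanSpace ℝ (Fin d)))
    (u : EuclideanSpace ℝ (Fin d) → ℝ)
    (G : EuclideanSpace ℝ (Fin d) → EuclideanSpace ℝ (Fin d)) : Prop where
  locallyIntegrable : LocallyIntegrableOn u U
  locallyIntegrable_grad : LocallyIntegrableOn G U
  integral_eq : ∀ φ : EuclideanSpace ℝ (Fin d) → ℝ, IsTestFunction U φ → ∀ i : Fin d,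
    ∫ x in U, u x * gradient φ x i = -∫ x in U, G x i * φ x

/-- `u ∈ H^{1,2}(U)`, with weak gradient `G`. -/
structure MemSobolev {d : ℕ} (U : Set (EuclideanSpace ℝ (Fin d)))
    (u : EuclideanSpace ℝ (Fin d) → ℝ)
    (G : EuclideanSpace ℝ (Fin d) → EuclideanSpace ℝ (Fin d)) : Prop where
  memLp : MemLp u 2 (volume.restrict U)
  memLp_grad : MemLp G 2 (volume.restrict U)
  hasWeakGradient : HasWeakGradient U u G

/-- `(‖u‖_{L²(U)}² + ∑ᵢ ‖Gᵢ‖_{L²(U)}²)^{1/2}`: the norm of `H^{1,2}(U)` at a function `u` whose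
weak gradient is `G`. -/
noncomputable def sobolevNorm {d : ℕ} (U : Set (EuclideanSpace ℝ (Fin d)))
    (u : EuclideanSpace ℝ (Fin d) → ℝ)
    (G : EuclideanSpace ℝ (Fin d) → EuclideanSpace ℝ (Fin d)) : ℝ≥0∞ :=
  (eLpNorm u 2 (volume.restrict U) ^ 2
    + ∑ i : Fin d, eLpNorm (fun x => G x i) 2 (volume.restrict U) ^ 2) ^ (1 / 2 : ℝ)

/-- `u ∈ H^{1,2}_0(U)`, with weak gradient `G`: `u` lies in the closure of `C_0^∞(U)` in
`H^{1,2}(U)`. -/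
structure MemSobolevZero {d : ℕ} (U : Set (EuclideanSpace ℝ (Fin d)))
    (u : EuclideanSpace ℝ (Fin d) → ℝ)
    (G : EuclideanSpace ℝ (Fin d) → EuclideanSpace ℝ (Fin d)) : Prop where
  memSobolev : MemSobolev U u G
  mem_closure : ∀ ε : ℝ≥0∞, 0 < ε → ∃ φ : EuclideanSpace ℝ (Fin d) → ℝ, IsTestFunction U φ ∧
    sobolevNorm U (fun x => u x - φ x) (fun x => G x - gradient φ x) < ε

/-- `p` is an admissible value of the exponent `2_*` in dimension `d`: `2d/(d+2)` if `d ≥ 3`, any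
number of `(1, 2)` if `d = 2`. -/
def IsTwoLowerStar (d : ℕ) (p : ℝ) : Prop :=
  (3 ≤ d ∧ p = 2 * (d : ℝ) / ((d : ℝ) + 2)) ∨ (d = 2 ∧ 1 < p ∧ p < 2)

/-- `div B ≤ 0` weakly in `U`. -/
def WeakDivNonpos {d : ℕ} (U : Set (EuclideanSpace ℝ (Fin d)))
    (B : EuclideanSpace ℝ (Fin d) → EuclideanSpace ℝ (Fin d)) : Prop :=
  ∀ φ : EuclideanSpace ℝ (Fin d) → ℝ, IsTestFunction U φ → (∀ x, 0 ≤ φ x) →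
    0 ≤ ∫ x in U, inner ℝ (B x) (gradient φ x)

/-- The standing assumption (A) on the domain and the coefficients, with ellipticity constant
`lam` and with `p` in the role of `2_*`. -/
structure AssumptionA {d : ℕ} (lam p : ℝ) (U : Set (EuclideanSpace ℝ (Fin d)))
    (A : EuclideanSpace ℝ (Fin d) → Matrix (Fin d) (Fin d) ℝ)
    (B : EuclideanSpace ℝ (Fin d) → EuclideanSpace ℝ (Fin d))
    (c : EuclideanSpace ℝ (Fin d) → ℝ) (α : ℝ) : Prop where
  two_le_dim : 2 ≤ d
  isOpen : IsOpen U
  isBounded : Bornology.IsBounded U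
  lam_pos : 0 < lam
  memLp_A : ∀ i j, MemLp (fun x => A x i j) ∞ (volume.restrict U)
  elliptic : ∀ x ∈ U, ∀ ξ : EuclideanSpace ℝ (Fin d),
    lam * ‖ξ‖ ^ 2 ≤ inner ℝ (Matrix.toEuclideanLin (A x) ξ) ξ
  bounded : ∃ Lam : ℝ, 0 < Lam ∧ ∀ x ∈ U, ∀ i j, |A x i j| ≤ Lam
  memLp_B : MemLp B 2 (volume.restrict U)
  weakDiv : WeakDivNonpos U B
  alpha_nonneg : 0 ≤ α
  isTwoLowerStar : IsTwoLowerStar d p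
  memLp_c : MemLp c (ENNReal.ofReal p) (volume.restrict U)
  c_nonneg : ∀ᵐ x ∂(volume.restrict U), 0 ≤ c x

/-- `u ∈ H^{1,2}_0(U)` is a weak solution of
`-div(A∇u) + ⟨B, ∇u⟩ + (c + α) u = f - div F` in `U`, `u = 0` on `∂U`.
The weak gradient `G` is unique up to null sets; both integrals are required to exist. -/
def IsWeakSolution {d : ℕ} (U : Set (EuclideanSpace ℝ (Fin d)))
    (A : EuclideanSpace ℝ (Fin d) → Matrix (Fin d) (Fin d) ℝ)
    (B : EuclideanSpace ℝ (Fin d) → EuclideanSpace ℝ (Fin d))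
    (c : EuclideanSpace ℝ (Fin d) → ℝ) (α : ℝ)
    (f : EuclideanSpace ℝ (Fin d) → ℝ)
    (F : EuclideanSpace ℝ (Fin d) → EuclideanSpace ℝ (Fin d))
    (u : EuclideanSpace ℝ (Fin d) → ℝ) : Prop :=
  ∃ G : EuclideanSpace ℝ (Fin d) → EuclideanSpace ℝ (Fin d), MemSobolevZero U u G ∧
    ∀ φ : EuclideanSpace ℝ (Fin d) → ℝ, IsTestFunction U φ →
      IntegrableOn (fun x => inner ℝ (Matrix.toEuclideanLin (A x) (G x)) (gradient φ x)
        + (inner ℝ (B x) (G x) + (c x + α) * u x) * φ x) U ∧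
      IntegrableOn (fun x => f x * φ x + inner ℝ (F x) (gradient φ x)) U ∧
      ∫ x in U, (inner ℝ (Matrix.toEuclideanLin (A x) (G x)) (gradient φ x)
        + (inner ℝ (B x) (G x) + (c x + α) * u x) * φ x)
      = ∫ x in U, (f x * φ x + inner ℝ (F x) (gradient φ x))

/-- `w ∈ H^{1,2}_0(U)` is a weak solution of the dual problem
`-div(A∇w + wB) + (c + α) w = f - div F` in `U`, `w = 0` on `∂U`. -/
def IsWeakSolutionDual {d : ℕ} (U : Set (EuclideanSpace ℝ (Fin d)))
    (A : EuclideanSpace ℝ (Fin d) → Matrix (Fin d) (Fin d) ℝ)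
    (B : EuclideanSpace ℝ (Fin d) → EuclideanSpace ℝ (Fin d))
    (c : EuclideanSpace ℝ (Fin d) → ℝ) (α : ℝ)
    (f : EuclideanSpace ℝ (Fin d) → ℝ)
    (F : EuclideanSpace ℝ (Fin d) → EuclideanSpace ℝ (Fin d))
    (w : EuclideanSpace ℝ (Fin d) → ℝ) : Prop :=
  ∃ G : EuclideanSpace ℝ (Fin d) → EuclideanSpace ℝ (Fin d), MemSobolevZero U w G ∧
    ∀ φ : EuclideanSpace ℝ (Fin d) → ℝ, IsTestFunction U φ →
      IntegrableOn (fun x => inner ℝ (Matrix.toEuclideanLin (A x) (G x) + w x • B x)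
        (gradient φ x) + (c x + α) * w x * φ x) U ∧
      IntegrableOn (fun x => f x * φ x + inner ℝ (F x) (gradient φ x)) U ∧
      ∫ x in U, (inner ℝ (Matrix.toEuclideanLin (A x) (G x) + w x • B x) (gradient φ x)
        + (c x + α) * w x * φ x)
      = ∫ x in U, (f x * φ x + inner ℝ (F x) (gradient φ x))

/-! The proof is Stampacchia's truncation method. Test either equation with `ψ(u)`, where `ψ` is
smooth, bounded, nondecreasing and vanishes at `0`. Ellipticity bounds the principal part below by
`λ ∫ |∇u|² ψ'(u)`, and the zeroth-order term is nonnegative because `t ψ(t) ≥ 0`. The drift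
contributes `∫ ⟨B, ∇u⟩ g(u)` with `g(t) = ψ(t)`, or `g(t) = t ψ'(t)` in the dual problem. In both
cases `t g(t) ≥ 0`, so the integrand is `⟨B, ∇Ψ(u)⟩` with a primitive `Ψ ≥ 0`, and `div B ≤ 0` makes
the term nonnegative. Both problems thus yield the same `EnergyInequality`, from which `Λ`, `B`,
`c`, `α` and `2_*` have disappeared; this is why the constant does not depend on them.

Now let `ψ` rise from `0` to `δ` between the levels `k` and `k + δ`, with slope bounded
independently of both. Hölder and Young bound `∫ |∇u|² ψ'(u)` by the data times `|{|u| > k}|^(1 -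
1/q)`. Cauchy-Schwarz and the Sobolev inequality in `W^{1,1}`, which needs no distinction between `d
= 2` and `d ≥ 3`, turn this into the decay estimate `exists_measure_decay`. Its exponents satisfy `2
- 2/d < 2 - 1/q` exactly because `q > d/2`. The iteration `exists_level_eq_zero` then gives a level,
linear in the data, above which `|u|` lives on a null set. -/

open Filter Topology

/-! ### Test functions and smooth composition -/

section TestFunction

variable {d : ℕ} {U : Set (EuclideanSpace ℝ (Fin d))} {φ : EuclideanSpace ℝ (Fin d) → ℝ}

lemma IsTestFunction.differentiable (hφ : IsTestFunction U φ) : Differentiable ℝ φ :=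
  hφ.smooth.differentiable (by simp)

lemma gradient_comp_eq_deriv_smul {g : ℝ → ℝ} (hg : Differentiable ℝ g)
    (hφ : Differentiable ℝ φ) (x : EuclideanSpace ℝ (Fin d)) :
    gradient (fun y => g (φ y)) x = deriv g (φ x) • gradient φ x := by
  apply HasGradientAt.gradient
  rw [hasGradientAt_iff_hasFDerivAt]
  have h := (hg (φ x)).hasDerivAt.comp_hasFDerivAt x (hφ x).hasFDerivAt
  simpa [toDual_gradient, Function.comp_def] using h

lemma IsTestFunction.comp {g : ℝ → ℝ} (hφ : IsTestFunction U φ) (hg : ContDiff ℝ ∞ g)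
    (h0 : g 0 = 0) : IsTestFunction U (fun x => g (φ x)) where
  smooth := hg.comp hφ.smooth
  compact := hφ.compact.comp_left h0
  support_subset := (closure_mono (Function.support_comp_subset h0 φ)).trans hφ.support_subset

lemma IsTestFunction.continuous_gradient (hφ : IsTestFunction U φ) : Continuous (gradient φ) := by
  have h : Continuous (fderiv ℝ φ) := hφ.smooth.continuous_fderiv (by simp)
  exact (InnerProductSpace.toDual ℝ (EuclideanSpace ℝ (Fin d))).symm.continuous.comp h

lemma norm_gradient (φ : EuclideanSpace ℝ (Fin d) → ℝ) (x : EuclideanSpace ℝ (Fin d)) :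
    ‖gradient φ x‖ = ‖fderiv ℝ φ x‖ := by
  rw [gradient]; simp

lemma IsTestFunction.memLp_gradient (hφ : IsTestFunction U φ) (p : ℝ≥0∞) :
    MemLp (gradient φ) p (volume.restrict U) := by
  refine (hφ.continuous_gradient.memLp_of_hasCompactSupport (μ := volume) ?_).restrict U
  have h : HasCompactSupport (fderiv ℝ φ) := hφ.compact.fderiv ℝ
  exact h.comp_left (g := (InnerProductSpace.toDual ℝ (EuclideanSpace ℝ (Fin d))).symm) (map_zero _)

end TestFunction

/-- A smooth `g` with `t * g t ≥ 0` has a nonnegative smooth primitive vanishing at `0`. -/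
lemma exists_nonneg_primitive {g : ℝ → ℝ} (hg : ContDiff ℝ ∞ g) (hs : ∀ t, 0 ≤ t * g t) :
    ∃ Ψ : ℝ → ℝ, ContDiff ℝ ∞ Ψ ∧ Ψ 0 = 0 ∧ (∀ t, 0 ≤ Ψ t) ∧ deriv Ψ = g := by
  have hd : ∀ t, HasDerivAt (fun t => ∫ s in (0 : ℝ)..t, g s) (g t) t := fun t =>
    intervalIntegral.integral_hasDerivAt_right (hg.continuous.intervalIntegrable _ _)
      (hg.continuous.stronglyMeasurableAtFilter _ _) hg.continuous.continuousAt
  have hd' : deriv (fun t => ∫ s in (0 : ℝ)..t, g s) = g := funext fun t => (hd t).deriv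
  refine ⟨fun t => ∫ s in (0 : ℝ)..t, g s, ?_, by simp, fun t => ?_, hd'⟩
  · exact contDiff_infty_iff_deriv.2 ⟨fun t => (hd t).differentiableAt, by rwa [hd']⟩
  · rcases le_total 0 t with ht | ht
    · refine intervalIntegral.integral_nonneg_of_ae_restrict ht ?_
      -- The sign condition says nothing directly about `g 0`, so the null point `0` is discarded.
      have h0 : ∀ᵐ s : ℝ, s ≠ 0 := by simp [ae_iff]
      filter_upwards [ae_restrict_mem measurableSet_Icc, ae_restrict_of_ae h0] with s hs1 hs2
      exact nonneg_of_mul_nonneg_right (hs s) (lt_of_le_of_ne hs1.1 (Ne.symm hs2))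
    · show 0 ≤ ∫ s in (0 : ℝ)..t, g s
      rw [intervalIntegral.integral_symm, ← intervalIntegral.integral_neg]
      refine intervalIntegral.integral_nonneg_of_ae_restrict ht ?_
      have h0 : ∀ᵐ s : ℝ, s ≠ 0 := by simp [ae_iff]
      filter_upwards [ae_restrict_mem measurableSet_Icc, ae_restrict_of_ae h0] with s hs1 hs2
      have : s < 0 := lt_of_le_of_ne hs1.2 hs2
      have := hs s
      simp only [Pi.zero_apply]
      nlinarith

/-- `φ n` are test functions converging to `u` almost everywhere, with gradients converging to `G`
in `L²(U)`. -/
structure IsTestApproximation {d : ℕ} (U : Set (EuclideanSpace ℝ (Fin d)))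
    (u : EuclideanSpace ℝ (Fin d) → ℝ) (G : EuclideanSpace ℝ (Fin d) → EuclideanSpace ℝ (Fin d))
    (φ : ℕ → EuclideanSpace ℝ (Fin d) → ℝ) : Prop where
  isTestFunction : ∀ n, IsTestFunction U (φ n)
  memLp : MemLp G 2 (volume.restrict U)
  tendsto_ae : ∀ᵐ x ∂volume.restrict U, Tendsto (fun n => φ n x) atTop (𝓝 (u x))
  tendsto_grad : Tendsto (fun n => eLpNorm (fun x => gradient (φ n) x - G x) 2 (volume.restrict U))
    atTop (𝓝 0)

/-! ### Passing to the limit from test functions to `H^{1,2}_0(U)` -/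

section Approximation

variable {d : ℕ} {U : Set (EuclideanSpace ℝ (Fin d))} {u : EuclideanSpace ℝ (Fin d) → ℝ}
  {G : EuclideanSpace ℝ (Fin d) → EuclideanSpace ℝ (Fin d)}
  {φ : ℕ → EuclideanSpace ℝ (Fin d) → ℝ}

lemma sq_rpow_half (a : ℝ≥0∞) : (a ^ 2) ^ (1 / 2 : ℝ) = a := by
  rw [← ENNReal.rpow_natCast, ← ENNReal.rpow_mul]; norm_num

lemma eLpNorm_le_sobolevNorm : eLpNorm u 2 (volume.restrict U) ≤ sobolevNorm U u G := by
  rw [← sq_rpow_half (eLpNorm u 2 (volume.restrict U)), sobolevNorm]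
  gcongr
  exact le_self_add

lemma eLpNorm_apply_le_sobolevNorm (i : Fin d) :
    eLpNorm (fun x => G x i) 2 (volume.restrict U) ≤ sobolevNorm U u G := by
  rw [← sq_rpow_half (eLpNorm (fun x => G x i) 2 (volume.restrict U)), sobolevNorm]
  gcongr
  exact (Finset.single_le_sum (f := fun i => eLpNorm (fun x => G x i) 2 (volume.restrict U) ^ 2)
    (fun _ _ => zero_le) (Finset.mem_univ i)).trans le_add_self

/-- The Euclidean length is at most the sum of the `|G_i|`, and Minkowski's inequality does the
rest. The factor `d` is crude, but only convergence to zero is at stake. -/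
lemma eLpNorm_le_card_mul_sobolevNorm (hG : AEStronglyMeasurable G (volume.restrict U)) :
    eLpNorm G 2 (volume.restrict U) ≤ d * sobolevNorm U u G := by
  have hi : ∀ i, AEStronglyMeasurable (fun x => G x i) (volume.restrict U) := fun i =>
    (EuclideanSpace.proj (𝕜 := ℝ) i).continuous.comp_aestronglyMeasurable hG
  calc eLpNorm G 2 (volume.restrict U)
      ≤ eLpNorm (∑ i : Fin d, fun x => |G x i|) 2 (volume.restrict U) := by
        refine eLpNorm_mono_real fun x => ?_
        rw [Finset.sum_apply, EuclideanSpace.norm_eq]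
        refine Real.sqrt_le_iff.2 ⟨Finset.sum_nonneg fun i _ => abs_nonneg _, ?_⟩
        simp only [Real.norm_eq_abs]
        exact Finset.sum_sq_le_sq_sum_of_nonneg fun i _ => abs_nonneg _
    _ ≤ ∑ i : Fin d, eLpNorm (fun x => |G x i|) 2 (volume.restrict U) :=
        eLpNorm_sum_le (fun i _ => (hi i).norm) (by norm_num)
    _ ≤ ∑ i : Fin d, sobolevNorm U u G := by
        refine Finset.sum_le_sum fun i _ => ?_
        exact (eLpNorm_norm (fun x => G x i)).trans_le (eLpNorm_apply_le_sobolevNorm i)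
    _ = d * sobolevNorm U u G := by simp

/-- Test functions within `1/(n+1)` converge in `H^{1,2}(U)`; a subsequence also converges almost
everywhere, which is what composition with nonlinear functions needs. -/
lemma MemSobolevZero.exists_testApproximation (h : MemSobolevZero U u G) :
    ∃ φ, IsTestApproximation U u G φ := by
  have hpos : ∀ n : ℕ, (0 : ℝ≥0∞) < ((n : ℝ≥0∞) + 1)⁻¹ := fun n => by simp
  choose φ hφ hlt using fun n : ℕ => h.mem_closure _ (hpos n)
  have hlim : Tendsto (fun n => sobolevNorm U (fun x => u x - φ n x)
      (fun x => G x - gradient (φ n) x)) atTop (𝓝 0) := by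
    refine tendsto_of_tendsto_of_tendsto_of_le_of_le tendsto_const_nhds ?_
      (fun _ => zero_le) (fun n => (hlt n).le)
    have := (tendsto_add_atTop_iff_nat 1).2 ENNReal.tendsto_inv_nat_nhds_zero
    simpa using this
  have hmeas : ∀ n, AEStronglyMeasurable (fun x => G x - gradient (φ n) x) (volume.restrict U) :=
    fun n => h.memSobolev.memLp_grad.1.sub (hφ n).continuous_gradient.aestronglyMeasurable
  have hgrad : Tendsto (fun n => eLpNorm (fun x => gradient (φ n) x - G x) 2 (volume.restrict U))
      atTop (𝓝 0) := by
    have h1 : Tendsto (fun n => d * sobolevNorm U (fun x => u x - φ n x)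
      (fun x => G x - gradient (φ n) x)) atTop (𝓝 0) := by
      simpa using ENNReal.Tendsto.const_mul hlim (Or.inr (ENNReal.natCast_ne_top d))
    refine tendsto_of_tendsto_of_tendsto_of_le_of_le tendsto_const_nhds h1
      (fun _ => zero_le) (fun n => ?_)
    refine le_trans (le_of_eq ?_) (eLpNorm_le_card_mul_sobolevNorm (hmeas n))
    exact eLpNorm_sub_comm _ _ _ _
  have hL2 : Tendsto (fun n => eLpNorm (φ n - u) 2 (volume.restrict U)) atTop (𝓝 0) := by
    refine tendsto_of_tendsto_of_tendsto_of_le_of_le tendsto_const_nhds hlim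
      (fun _ => zero_le) (fun n => ?_)
    rw [eLpNorm_sub_comm]
    exact eLpNorm_le_sobolevNorm
  obtain ⟨ns, hns, hae⟩ := (tendstoInMeasure_of_tendsto_eLpNorm (by norm_num)
    (fun n => (hφ n).smooth.continuous.aestronglyMeasurable)
    h.memSobolev.memLp.1 hL2).exists_seq_tendsto_ae
  exact ⟨fun n => φ (ns n), fun n => hφ _, h.memSobolev.memLp_grad, hae,
    hgrad.comp hns.tendsto_atTop⟩

lemma IsTestApproximation.tendsto_integral_mul (h : IsTestApproximation U u G φ) {g : ℝ → ℝ}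
    (hg : Continuous g) {K : ℝ} (hK : ∀ t, |g t| ≤ K) {f : EuclideanSpace ℝ (Fin d) → ℝ}
    (hf : IntegrableOn f U) :
    Tendsto (fun n => ∫ x in U, f x * g (φ n x)) atTop (𝓝 (∫ x in U, f x * g (u x))) := by
  refine tendsto_integral_of_dominated_convergence (fun x => ‖f x‖ * K) (fun n => ?_)
    (hf.norm.mul_const K) (fun n => ?_) ?_
  · exact hf.1.mul
      (hg.comp (h.isTestFunction n).smooth.continuous).aestronglyMeasurable
  · refine Eventually.of_forall fun x => ?_
    rw [norm_mul]
    exact mul_le_mul_of_nonneg_left (hK _) (norm_nonneg _)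
  · filter_upwards [h.tendsto_ae] with x hx
    exact ((hg.tendsto _).comp hx).const_mul _

lemma IsTestApproximation.aestronglyMeasurable (h : IsTestApproximation U u G φ) :
    AEStronglyMeasurable u (volume.restrict U) :=
  aestronglyMeasurable_of_tendsto_ae atTop
    (fun n => (h.isTestFunction n).smooth.continuous.aestronglyMeasurable) h.tendsto_ae

lemma MeasureTheory.MemLp.integrable_inner_of_two {μ : Measure (EuclideanSpace ℝ (Fin d))}
    {H K : EuclideanSpace ℝ (Fin d) → EuclideanSpace ℝ (Fin d)}
    (hH : MemLp H 2 μ) (hK : MemLp K 2 μ) : Integrable (fun x => inner ℝ (H x) (K x)) μ := by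
  rw [← memLp_one_iff_integrable]
  refine MemLp.of_bilin (fun a b => inner ℝ a b) 1 hH hK (hH.1.inner hK.1)
    (Eventually.of_forall fun x => ?_)
  simpa using nnnorm_inner_le_nnnorm (𝕜 := ℝ) (H x) (K x)

/-- Split `∇φ_n = (∇φ_n - G) + G`. The first part vanishes by Cauchy-Schwarz, since `g` is bounded;
the second converges by dominated convergence. No uniform bound on the `φ_n` is needed. -/
lemma IsTestApproximation.tendsto_integral_inner (h : IsTestApproximation U u G φ) {g : ℝ → ℝ}
    (hg : Continuous g) {K : ℝ} (hK : ∀ t, |g t| ≤ K)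
    {H : EuclideanSpace ℝ (Fin d) → EuclideanSpace ℝ (Fin d)}
    (hH : MemLp H 2 (volume.restrict U)) :
    Tendsto (fun n => ∫ x in U, inner ℝ (H x) (gradient (φ n) x) * g (φ n x)) atTop
      (𝓝 (∫ x in U, inner ℝ (H x) (G x) * g (u x))) := by
  have hK0 : 0 ≤ K := (abs_nonneg _).trans (hK 0)
  have hgφ : ∀ n, AEStronglyMeasurable (fun x => g (φ n x)) (volume.restrict U) := fun n =>
    (hg.comp (h.isTestFunction n).smooth.continuous).aestronglyMeasurable
  have hD : ∀ n, MemLp (fun x => gradient (φ n) x - G x) 2 (volume.restrict U) := fun n =>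
    ((h.isTestFunction n).memLp_gradient 2).sub h.memLp
  have hI : ∀ n, Integrable (fun x => inner ℝ (H x) (gradient (φ n) x - G x) * g (φ n x))
      (volume.restrict U) := fun n =>
    (hH.integrable_inner_of_two (hD n)).mul_bdd (c := K) (hgφ n)
      (Eventually.of_forall fun x => by simpa using hK (φ n x))
  have hI' : ∀ n, Integrable (fun x => inner ℝ (H x) (G x) * g (φ n x))
      (volume.restrict U) := fun n =>
    (hH.integrable_inner_of_two h.memLp).mul_bdd (c := K) (hgφ n)
      (Eventually.of_forall fun x => by simpa using hK (φ n x))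
  have h1 := h.tendsto_integral_mul hg hK (hH.integrable_inner_of_two h.memLp)
  have h2 : Tendsto (fun n => ∫ x in U, inner ℝ (H x) (gradient (φ n) x - G x) * g (φ n x))
      atTop (𝓝 0) := by
    have hb : ∀ n, eLpNorm (fun x => inner ℝ (H x) (gradient (φ n) x - G x) * g (φ n x)) 1
        (volume.restrict U) ≤ K.toNNReal * eLpNorm H 2 (volume.restrict U)
          * eLpNorm (fun x => gradient (φ n) x - G x) 2 (volume.restrict U) := by
      intro n
      have hle : ∀ x, ‖inner ℝ (H x) (gradient (φ n) x - G x) * g (φ n x)‖ ≤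
          K.toNNReal * ‖H x‖ * ‖gradient (φ n) x - G x‖ := by
        intro x
        rw [Real.coe_toNNReal K hK0, norm_mul, mul_comm, mul_assoc]
        exact mul_le_mul (hK _) (norm_inner_le_norm _ _) (norm_nonneg _) hK0
      refine le_trans (eLpNorm_mono_real (g := fun x => K.toNNReal * ‖H x‖ *
        ‖gradient (φ n) x - G x‖) hle) ?_
      refine eLpNorm_le_eLpNorm_mul_eLpNorm'_of_norm hH.1 (hD n).1
        (fun a b => (K.toNNReal * ‖a‖ * ‖b‖ : ℝ)) K.toNNReal (Eventually.of_forall fun x => ?_)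
      rw [Real.norm_of_nonneg (by positivity)]
    have hz : Tendsto (fun n => K.toNNReal * eLpNorm H 2 (volume.restrict U)
        * eLpNorm (fun x => gradient (φ n) x - G x) 2 (volume.restrict U)) atTop (𝓝 0) := by
      simpa using ENNReal.Tendsto.const_mul h.tendsto_grad
        (Or.inr (ENNReal.mul_ne_top ENNReal.coe_ne_top hH.eLpNorm_ne_top))
    have := tendsto_integral_of_L1' (0 : EuclideanSpace ℝ (Fin d) → ℝ)
      (integrable_zero _ _ _).aestronglyMeasurable
      (Eventually.of_forall hI)
      (tendsto_of_tendsto_of_tendsto_of_le_of_le tendsto_const_nhds hz (fun _ => zero_le)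
        (fun n => by simpa only [sub_zero] using hb n))
    simpa using this
  have h3 := h2.add h1
  rw [zero_add] at h3
  refine h3.congr fun n => ?_
  rw [← integral_add (hI n) (hI' n)]
  refine integral_congr_ae (Eventually.of_forall fun x => ?_)
  simp only [inner_sub_right]
  ring

/-- If `div B ≤ 0` weakly, then `∫ ⟨B, ∇u⟩ g(u) ≥ 0` whenever `t g(t) ≥ 0`. -/
lemma IsTestApproximation.integral_inner_mul_nonneg (h : IsTestApproximation U u G φ)
    {B : EuclideanSpace ℝ (Fin d) → EuclideanSpace ℝ (Fin d)}
    (hB : MemLp B 2 (volume.restrict U)) (hdiv : WeakDivNonpos U B) {g : ℝ → ℝ}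
    (hg : ContDiff ℝ ∞ g) {K : ℝ} (hK : ∀ t, |g t| ≤ K) (hs : ∀ t, 0 ≤ t * g t) :
    0 ≤ ∫ x in U, inner ℝ (B x) (G x) * g (u x) := by
  refine ge_of_tendsto' (h.tendsto_integral_inner hg.continuous hK hB) fun n => ?_
  -- `Ψ(φ_n)` is a nonnegative test function with gradient `g(φ_n) ∇φ_n`, hence admissible in `div B
  -- ≤ 0`.
  obtain ⟨Ψ, hΨ, hΨ0, hΨnn, hΨd⟩ := exists_nonneg_primitive hg hs
  refine (hdiv _ ((h.isTestFunction n).comp hΨ hΨ0) fun x => hΨnn _).trans_eq ?_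
  refine integral_congr_ae (Eventually.of_forall fun x => ?_)
  simp only
  rw [gradient_comp_eq_deriv_smul (hΨ.differentiable (by simp))
    (h.isTestFunction n).differentiable, hΨd, inner_smul_right, mul_comm]

/-- The Gagliardo-Nirenberg-Sobolev inequality in `W^{1,1}` for a smooth function of `u`. -/
lemma IsTestApproximation.lintegral_rpow_le (h : IsTestApproximation U u G φ)
    [IsFiniteMeasure (volume.restrict U)] {ψ : ℝ → ℝ} (hψ : ContDiff ℝ ∞ ψ) (hψ0 : ψ 0 = 0)
    {K : ℝ} (hK : ∀ t, |deriv ψ t| ≤ K) {r : ℝ} (hr : Real.HolderConjugate d r) :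
    ∫⁻ x in U, ‖ψ (u x)‖ₑ ^ r ≤
      lintegralPowLePowLIntegralFDerivConst (volume : Measure (EuclideanSpace ℝ (Fin d))) r
        * ENNReal.ofReal (∫ x in U, ‖G x‖ * |deriv ψ (u x)|) ^ r := by
  have hr0 : 0 < r := hr.symm.pos
  have hK0 : 0 ≤ K := (abs_nonneg _).trans (hK 0)
  have hψ' : Continuous (deriv ψ) := hψ.continuous_deriv (by simp)
  set c := lintegralPowLePowLIntegralFDerivConst
    (volume : Measure (EuclideanSpace ℝ (Fin d))) r with hc
  have hD : ∀ n, Integrable (fun x => ‖gradient (φ n) x - G x‖) (volume.restrict U) := fun n =>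
    ((((h.isTestFunction n).memLp_gradient 2).sub h.memLp).integrable (by norm_num)).norm
  have hGi : Integrable (fun x => ‖G x‖) (volume.restrict U) :=
    (h.memLp.integrable (by norm_num)).norm
  have hgφ : ∀ n, AEStronglyMeasurable (fun x => |deriv ψ (φ n x)|) (volume.restrict U) := fun n =>
    (hψ'.abs.comp (h.isTestFunction n).smooth.continuous).aestronglyMeasurable
  have hGψ : ∀ n, Integrable (fun x => ‖G x‖ * |deriv ψ (φ n x)|) (volume.restrict U) := fun n =>
    hGi.mul_bdd (c := K) (hgφ n) (Eventually.of_forall fun x => by simpa using hK (φ n x))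
  -- Sobolev for the test function `ψ(φ_n)`. Replacing `∇φ_n` by `G` costs an error which vanishes
  -- in the limit, so `K` drops out of the final bound.
  have hstep : ∀ n, ∫⁻ x in U, ‖ψ (φ n x)‖ₑ ^ r ≤ c * ENNReal.ofReal
      ((∫ x in U, ‖G x‖ * |deriv ψ (φ n x)|) + K * ∫ x in U, ‖gradient (φ n) x - G x‖) ^ r := by
    intro n
    have ht := (h.isTestFunction n).comp hψ hψ0
    have hgns := lintegral_pow_le_pow_lintegral_fderiv (u := fun x => ψ (φ n x))
      (volume : Measure (EuclideanSpace ℝ (Fin d)))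
      (ht.smooth.of_le (by simp)) ht.compact (p := r) (by simpa using hr)
    refine (setLIntegral_le_lintegral _ _).trans (hgns.trans ?_)
    gcongr
    have hsupp : ∀ x, x ∉ U → ‖fderiv ℝ (fun x => ψ (φ n x)) x‖ₑ = 0 := by
      intro x hx
      have : x ∉ tsupport (fderiv ℝ fun x => ψ (φ n x)) := fun hx' =>
        hx (ht.support_subset (tsupport_fderiv_subset ℝ hx'))
      rw [image_eq_zero_of_notMem_tsupport this, ← ofReal_norm, norm_zero, ENNReal.ofReal_zero]
    rw [← setLIntegral_eq_of_support_subset (s := U) (fun x hx => by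
      by_contra hxU; exact hx (hsupp x hxU))]
    rw [← integral_const_mul, ← integral_add (hGψ n) ((hD n).const_mul K),
      ofReal_integral_eq_lintegral_ofReal (f := fun x => ‖G x‖ * |deriv ψ (φ n x)| +
        K * ‖gradient (φ n) x - G x‖) ((hGψ n).add ((hD n).const_mul K))
        (Eventually.of_forall fun x => by
          simp only [Pi.zero_apply]
          positivity)]
    refine lintegral_mono fun x => ?_
    rw [← ofReal_norm]
    refine ENNReal.ofReal_le_ofReal ?_
    rw [← norm_gradient, gradient_comp_eq_deriv_smul (hψ.differentiable (by simp))
      (h.isTestFunction n).differentiable, norm_smul, Real.norm_eq_abs]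
    have h1 : ‖gradient (φ n) x‖ ≤ ‖G x‖ + ‖gradient (φ n) x - G x‖ := by
      have := norm_add_le (G x) (gradient (φ n) x - G x)
      simpa using this
    calc |deriv ψ (φ n x)| * ‖gradient (φ n) x‖
        ≤ |deriv ψ (φ n x)| * (‖G x‖ + ‖gradient (φ n) x - G x‖) := by gcongr
      _ ≤ _ := by
        rw [mul_add, mul_comm]
        gcongr
        exact hK _
  have hlim0 : Tendsto (fun n => ∫ x in U, ‖gradient (φ n) x - G x‖) atTop (𝓝 0) := by
    have hb : ∀ n, eLpNorm (fun x => ‖gradient (φ n) x - G x‖) 1 (volume.restrict U) ≤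
        eLpNorm (fun x => gradient (φ n) x - G x) 2 (volume.restrict U) *
          (volume.restrict U) Set.univ ^ (1 / (1 : ℝ≥0∞).toReal - 1 / (2 : ℝ≥0∞).toReal) := by
      intro n
      rw [eLpNorm_norm]
      exact eLpNorm_le_eLpNorm_mul_rpow_measure_univ (by norm_num)
        (((h.isTestFunction n).memLp_gradient 2).sub h.memLp).1
    have hz := ENNReal.Tendsto.mul_const (b := (volume.restrict U) Set.univ ^
      (1 / (1 : ℝ≥0∞).toReal - 1 / (2 : ℝ≥0∞).toReal)) h.tendsto_grad
      (Or.inr (ENNReal.rpow_ne_top_of_nonneg (by norm_num) (measure_ne_top _ _)))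
    rw [zero_mul] at hz
    have := tendsto_integral_of_L1' (0 : EuclideanSpace ℝ (Fin d) → ℝ)
      (integrable_zero _ _ _).aestronglyMeasurable
      (Eventually.of_forall hD)
      (tendsto_of_tendsto_of_tendsto_of_le_of_le tendsto_const_nhds hz (fun _ => zero_le)
        (fun n => by simpa only [sub_zero] using hb n))
    simpa using this
  have hlim1 := (h.tendsto_integral_mul hψ'.abs (by simpa using hK) hGi).add (hlim0.const_mul K)
  rw [mul_zero, add_zero] at hlim1
  have hlim2 := ENNReal.Tendsto.const_mul (a := (c : ℝ≥0∞))
    ((ENNReal.tendsto_ofReal hlim1).ennrpow_const r) (Or.inr ENNReal.coe_ne_top)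
  have hpt : ∀ᵐ x ∂volume.restrict U,
      Tendsto (fun n => ‖ψ (φ n x)‖ₑ ^ r) atTop (𝓝 (‖ψ (u x)‖ₑ ^ r)) := by
    filter_upwards [h.tendsto_ae] with x hx
    exact (((hψ.continuous.tendsto _).comp hx).enorm).ennrpow_const r
  -- Fatou's lemma on the left-hand side, a genuine limit on the right-hand side.
  calc ∫⁻ x in U, ‖ψ (u x)‖ₑ ^ r
      = ∫⁻ x in U, liminf (fun n => ‖ψ (φ n x)‖ₑ ^ r) atTop :=
        lintegral_congr_ae (hpt.mono fun x hx => hx.liminf_eq.symm)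
    _ ≤ liminf (fun n => ∫⁻ x in U, ‖ψ (φ n x)‖ₑ ^ r) atTop :=
        lintegral_liminf_le' fun n =>
          ((hψ.continuous.comp (h.isTestFunction n).smooth.continuous).enorm.measurable.pow_const
            r).aemeasurable
    _ ≤ liminf (fun n => c * ENNReal.ofReal ((∫ x in U, ‖G x‖ * |deriv ψ (φ n x)|)
          + K * ∫ x in U, ‖gradient (φ n) x - G x‖) ^ r) atTop :=
        liminf_le_liminf (Eventually.of_forall hstep)
    _ = _ := hlim2.liminf_eq

end Approximation

/-! ### Truncations and the energy inequality -/

/-- Smooth bounded nondecreasing functions `ψ` vanishing at `0`, with `ψ'` and `t ψ'(t)` bounded. -/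
structure IsSmoothTruncation (ψ : ℝ → ℝ) (K : ℝ) : Prop where
  smooth : ContDiff ℝ ∞ ψ
  zero : ψ 0 = 0
  deriv_nonneg : ∀ t, 0 ≤ deriv ψ t
  abs_le : ∀ t, |ψ t| ≤ K
  abs_deriv_le : ∀ t, |deriv ψ t| ≤ K
  abs_mul_deriv_le : ∀ t, |t * deriv ψ t| ≤ K

namespace IsSmoothTruncation

variable {ψ : ℝ → ℝ} {K : ℝ}

lemma smooth_deriv (h : IsSmoothTruncation ψ K) : ContDiff ℝ ∞ (deriv ψ) :=
  (contDiff_infty_iff_deriv.1 h.smooth).2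

lemma continuous_deriv (h : IsSmoothTruncation ψ K) : Continuous (deriv ψ) :=
  h.smooth_deriv.continuous

lemma mul_nonneg (h : IsSmoothTruncation ψ K) (t : ℝ) : 0 ≤ t * ψ t := by
  have hm : Monotone ψ := monotone_of_deriv_nonneg (h.smooth.differentiable (by simp))
    h.deriv_nonneg
  rcases le_total 0 t with ht | ht
  · have := hm ht
    rw [h.zero] at this
    positivity
  · have := hm ht
    rw [h.zero] at this
    nlinarith

end IsSmoothTruncation

section Energy

variable {d : ℕ} {U : Set (EuclideanSpace ℝ (Fin d))} {u : EuclideanSpace ℝ (Fin d) → ℝ}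
  {G : EuclideanSpace ℝ (Fin d) → EuclideanSpace ℝ (Fin d)}
  {φ : ℕ → EuclideanSpace ℝ (Fin d) → ℝ}

lemma MeasureTheory.Integrable.mul_comp_bounded {μ : Measure (EuclideanSpace ℝ (Fin d))}
    {f : EuclideanSpace ℝ (Fin d) → ℝ} (hf : Integrable f μ) {g : ℝ → ℝ} (hg : Continuous g)
    {K : ℝ} (hK : ∀ t, |g t| ≤ K) (hu : AEStronglyMeasurable u μ) :
    Integrable (fun x => f x * g (u x)) μ :=
  hf.mul_bdd (c := K) (hg.comp_aestronglyMeasurable hu) (Eventually.of_forall fun x => hK (u x))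

/-- Covers both problems: `H = A∇u`, `R = ⟨B, ∇u⟩ + (c + α)u` for the first, `H = A∇w + wB`, `R = (c
+ α)w` for the dual. Since `ψ(φ_n)` is again a test function, the equation is tested with it and `n
→ ∞`; thus `ψ(u)` is never shown to lie in `H^{1,2}_0(U)`. -/
lemma IsTestApproximation.weak_identity (h : IsTestApproximation U u G φ)
    {H F : EuclideanSpace ℝ (Fin d) → EuclideanSpace ℝ (Fin d)}
    {R f : EuclideanSpace ℝ (Fin d) → ℝ} (hH : MemLp H 2 (volume.restrict U))
    (hF : MemLp F 2 (volume.restrict U)) (hR : IntegrableOn R U) (hf : IntegrableOn f U)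
    (heq : ∀ φ : EuclideanSpace ℝ (Fin d) → ℝ, IsTestFunction U φ →
      ∫ x in U, (inner ℝ (H x) (gradient φ x) + R x * φ x)
        = ∫ x in U, (f x * φ x + inner ℝ (F x) (gradient φ x)))
    {ψ : ℝ → ℝ} {K : ℝ} (hψ : IsSmoothTruncation ψ K) :
    (∫ x in U, inner ℝ (H x) (G x) * deriv ψ (u x)) + ∫ x in U, R x * ψ (u x)
      = (∫ x in U, f x * ψ (u x)) + ∫ x in U, inner ℝ (F x) (G x) * deriv ψ (u x) := by
  have hφm : ∀ n, AEStronglyMeasurable (φ n) (volume.restrict U) := fun n =>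
    (h.isTestFunction n).smooth.continuous.aestronglyMeasurable
  have hl := (h.tendsto_integral_inner hψ.continuous_deriv hψ.abs_deriv_le hH).add
    (h.tendsto_integral_mul hψ.smooth.continuous hψ.abs_le hR)
  have hr := (h.tendsto_integral_mul hψ.smooth.continuous hψ.abs_le hf).add
    (h.tendsto_integral_inner hψ.continuous_deriv hψ.abs_deriv_le hF)
  refine tendsto_nhds_unique hl (hr.congr fun n => ?_)
  have hI : ∀ {L : EuclideanSpace ℝ (Fin d) → EuclideanSpace ℝ (Fin d)},
      MemLp L 2 (volume.restrict U) →
      Integrable (fun x => inner ℝ (L x) (gradient (φ n) x) * deriv ψ (φ n x))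
        (volume.restrict U) := fun hL =>
    (hL.integrable_inner_of_two ((h.isTestFunction n).memLp_gradient 2)).mul_comp_bounded
      hψ.continuous_deriv hψ.abs_deriv_le (hφm n)
  rw [← integral_add (hf.mul_comp_bounded hψ.smooth.continuous hψ.abs_le (hφm n)) (hI hF),
    ← integral_add (hI hH) (hR.mul_comp_bounded hψ.smooth.continuous hψ.abs_le (hφm n))]
  have := heq _ ((h.isTestFunction n).comp hψ.smooth hψ.zero)
  simp only [gradient_comp_eq_deriv_smul (hψ.smooth.differentiable (by simp))
    (h.isTestFunction n).differentiable, inner_smul_right] at this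
  simp only [mul_comm (inner ℝ _ _) _]
  exact this.symm

lemma memLp_toEuclideanLin {μ : Measure (EuclideanSpace ℝ (Fin d))}
    {A : EuclideanSpace ℝ (Fin d) → Matrix (Fin d) (Fin d) ℝ}
    (hA : ∀ i j, MemLp (fun x => A x i j) ∞ μ) (hG : MemLp G 2 μ) :
    MemLp (fun x => Matrix.toEuclideanLin (A x) (G x)) 2 μ := by
  refine MemLp.of_eval_piLp fun i => ?_
  have : (fun x => Matrix.toEuclideanLin (A x) (G x) i) = fun x => ∑ j, A x i j * G x j := by
    ext x
    simp [Matrix.toLpLin_apply, Matrix.mulVec, dotProduct]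
  rw [this]
  exact memLp_finsetSum _ fun j _ => (hG.eval_piLp j).mul' (hA i j)

/-- The energy inequality obtained by testing the equation with truncations of the solution. -/
def EnergyInequality (lam : ℝ) (U : Set (EuclideanSpace ℝ (Fin d)))
    (f : EuclideanSpace ℝ (Fin d) → ℝ)
    (F : EuclideanSpace ℝ (Fin d) → EuclideanSpace ℝ (Fin d))
    (u : EuclideanSpace ℝ (Fin d) → ℝ)
    (G : EuclideanSpace ℝ (Fin d) → EuclideanSpace ℝ (Fin d)) : Prop :=
  ∀ (ψ : ℝ → ℝ) (K : ℝ), IsSmoothTruncation ψ K →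
    lam * ∫ x in U, ‖G x‖ ^ 2 * deriv ψ (u x) ≤
      (∫ x in U, f x * ψ (u x)) + ∫ x in U, inner ℝ (F x) (G x) * deriv ψ (u x)

lemma IsTwoLowerStar.one_le {p : ℝ} (h : IsTwoLowerStar d p) : 1 ≤ p := by
  rcases h with ⟨hd, rfl⟩ | ⟨-, h, -⟩
  · have : (3 : ℝ) ≤ d := by exact_mod_cast hd
    rw [le_div_iff₀ (by positivity)]
    linarith
  · exact h.le

namespace AssumptionA

variable {lam p : ℝ} {A : EuclideanSpace ℝ (Fin d) → Matrix (Fin d) (Fin d) ℝ}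
  {B F : EuclideanSpace ℝ (Fin d) → EuclideanSpace ℝ (Fin d)}
  {c f w : EuclideanSpace ℝ (Fin d) → ℝ} {α : ℝ}

lemma isFiniteMeasure (h : AssumptionA lam p U A B c α) : IsFiniteMeasure (volume.restrict U) :=
  isFiniteMeasure_restrict.2 h.isBounded.measure_lt_top.ne

/-- As `2_* ≥ 1` and `U` has finite measure, `c` is integrable; boundedness of `u` then suffices. -/
lemma integrable_zerothOrder (h : AssumptionA lam p U A B c α)
    (hu : MemLp u ∞ (volume.restrict U)) : IntegrableOn (fun x => (c x + α) * u x) U := by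
  have := h.isFiniteMeasure
  have hc : IntegrableOn c U := h.memLp_c.integrable (by simpa using h.isTwoLowerStar.one_le)
  exact memLp_one_iff_integrable.1
    (hu.mul' (memLp_one_iff_integrable.2 (hc.add (integrable_const α))))

lemma lam_mul_integral_le (h : AssumptionA lam p U A B c α) (ha : IsTestApproximation U u G φ)
    {ψ : ℝ → ℝ} {K : ℝ} (hψ : IsSmoothTruncation ψ K) :
    lam * ∫ x in U, ‖G x‖ ^ 2 * deriv ψ (u x) ≤
      ∫ x in U, inner ℝ (Matrix.toEuclideanLin (A x) (G x)) (G x) * deriv ψ (u x) := by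
  rw [← integral_const_mul]
  refine integral_mono_ae ?_ ?_ ?_
  · exact ((ha.memLp.integrable_norm_pow (by norm_num)).mul_comp_bounded hψ.continuous_deriv
      hψ.abs_deriv_le ha.aestronglyMeasurable).const_mul lam
  · exact ((memLp_toEuclideanLin h.memLp_A ha.memLp).integrable_inner_of_two
      ha.memLp).mul_comp_bounded hψ.continuous_deriv hψ.abs_deriv_le ha.aestronglyMeasurable
  · filter_upwards [ae_restrict_mem h.isOpen.measurableSet] with x hx
    rw [← mul_assoc]
    exact mul_le_mul_of_nonneg_right (h.elliptic x hx (G x)) (hψ.deriv_nonneg _)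

lemma integral_zerothOrder_nonneg (h : AssumptionA lam p U A B c α)
    {ψ : ℝ → ℝ} {K : ℝ} (hψ : IsSmoothTruncation ψ K) :
    0 ≤ ∫ x in U, (c x + α) * u x * ψ (u x) := by
  refine integral_nonneg_of_ae ?_
  filter_upwards [h.c_nonneg] with x hx
  rw [mul_assoc]
  exact mul_nonneg (add_nonneg hx h.alpha_nonneg) (hψ.mul_nonneg _)

/-- The drift term is nonnegative with `g = ψ`, and the zeroth-order term by the signs of `c`, `α`
and `t ψ(t)`; both can be dropped. -/
lemma energyInequality (h : AssumptionA lam p U A B c α) (hf : IntegrableOn f U)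
    (hF : MemLp F 2 (volume.restrict U)) (hu : MemLp u ∞ (volume.restrict U))
    (hsol : IsWeakSolution U A B c α f F u) :
    ∃ G, MemSobolevZero U u G ∧ EnergyInequality lam U f F u G := by
  obtain ⟨G, hG, heq⟩ := hsol
  refine ⟨G, hG, fun ψ K hψ => ?_⟩
  obtain ⟨φ, ha⟩ := hG.exists_testApproximation
  have hBG := h.memLp_B.integrable_inner_of_two ha.memLp
  have h0 := h.integrable_zerothOrder hu
  have hid := ha.weak_identity (memLp_toEuclideanLin h.memLp_A ha.memLp) hF (hBG.add h0) hf
    (fun φ hφ => (heq φ hφ).2.2) hψ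
  rw [← hid]
  have hsplit : ∫ x in U, ((fun x => inner ℝ (B x) (G x)) + fun x => (c x + α) * u x) x * ψ (u x)
      = (∫ x in U, inner ℝ (B x) (G x) * ψ (u x)) + ∫ x in U, (c x + α) * u x * ψ (u x) := by
    rw [← integral_add (hBG.mul_comp_bounded hψ.smooth.continuous hψ.abs_le
      ha.aestronglyMeasurable) (h0.mul_comp_bounded hψ.smooth.continuous hψ.abs_le
      ha.aestronglyMeasurable)]
    simp only [Pi.add_apply, add_mul]
  rw [hsplit]
  have h1 := h.lam_mul_integral_le ha hψ
  have h2 := ha.integral_inner_mul_nonneg h.memLp_B h.weakDiv hψ.smooth hψ.abs_le hψ.mul_nonneg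
  have h3 := h.integral_zerothOrder_nonneg (u := u) hψ
  linarith

/-- The drift now sits in the flux: `⟨wB, ∇w⟩ ψ'(w) = ⟨B, ∇w⟩ g(w)` with `g(t) = t ψ'(t)`, which
explains the bound on `t ψ'(t)` imposed on truncations. Boundedness of `w` puts `wB` in `L²`. -/
lemma energyInequality_dual (h : AssumptionA lam p U A B c α) (hf : IntegrableOn f U)
    (hF : MemLp F 2 (volume.restrict U)) (hw : MemLp w ∞ (volume.restrict U))
    (hsol : IsWeakSolutionDual U A B c α f F w) :
    ∃ G, MemSobolevZero U w G ∧ EnergyInequality lam U f F w G := by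
  obtain ⟨G, hG, heq⟩ := hsol
  refine ⟨G, hG, fun ψ K hψ => ?_⟩
  obtain ⟨φ, ha⟩ := hG.exists_testApproximation
  have hwB : MemLp (fun x => w x • B x) 2 (volume.restrict U) := h.memLp_B.smul hw
  have hAG := memLp_toEuclideanLin h.memLp_A ha.memLp
  have hid := ha.weak_identity (hAG.add hwB) hF (h.integrable_zerothOrder hw) hf
    (fun φ hφ => (heq φ hφ).2.2) hψ
  rw [← hid]
  have hsplit : ∫ x in U, inner ℝ (((fun x => Matrix.toEuclideanLin (A x) (G x)) +
      fun x => w x • B x) x) (G x) * deriv ψ (w x)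
      = (∫ x in U, inner ℝ (Matrix.toEuclideanLin (A x) (G x)) (G x) * deriv ψ (w x))
        + ∫ x in U, inner ℝ (B x) (G x) * (w x * deriv ψ (w x)) := by
    rw [← integral_add ((hAG.integrable_inner_of_two ha.memLp).mul_comp_bounded
      hψ.continuous_deriv hψ.abs_deriv_le ha.aestronglyMeasurable)
      ((h.memLp_B.integrable_inner_of_two ha.memLp).mul_comp_bounded
      (g := fun t => t * deriv ψ t) (continuous_id.mul hψ.continuous_deriv)
      hψ.abs_mul_deriv_le ha.aestronglyMeasurable)]
    refine integral_congr_ae (Eventually.of_forall fun x => ?_)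
    simp only [Pi.add_apply, inner_add_left, inner_smul_left]
    simp only [conj_trivial]
    ring
  rw [hsplit]
  have h1 := h.lam_mul_integral_le ha hψ
  have h2 := ha.integral_inner_mul_nonneg h.memLp_B h.weakDiv
    (g := fun t => t * deriv ψ t) (contDiff_id.mul hψ.smooth_deriv) hψ.abs_mul_deriv_le
    (fun t => by
      rw [← mul_assoc]
      exact mul_nonneg (mul_self_nonneg t) (hψ.deriv_nonneg t))
  have h3 := h.integral_zerothOrder_nonneg (u := w) hψ
  linarith

end AssumptionA

end Energy

/-! ### Construction of the truncations -/

/-- A smooth odd truncation which vanishes on `[-k, k]` and equals `± δ` outside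
`(-(k + δ), k + δ)`, with a bound `L` on the slope that does not depend on `k` and `δ`. -/
lemma exists_smoothTruncation : ∃ L : ℝ, 0 < L ∧ ∀ k δ : ℝ, 0 ≤ k → 0 < δ →
    ∃ (ψ : ℝ → ℝ) (K : ℝ), IsSmoothTruncation ψ K ∧ (∀ t, |ψ t| ≤ δ) ∧ (∀ t, deriv ψ t ≤ L) ∧
      (∀ t, |t| ≤ k → ψ t = 0) ∧ (∀ t, |t| ≤ k → deriv ψ t = 0) ∧
      (∀ t, k + δ ≤ |t| → |ψ t| = δ) := by
  set S := Real.smoothTransition with hS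
  have hSc : ContDiff ℝ ∞ S := Real.smoothTransition.contDiff
  have hSd : Differentiable ℝ S := hSc.differentiable (by simp)
  have hSd' : Continuous (deriv S) := hSc.continuous_deriv (by simp)
  have hS0 : ∀ t, t ≤ 0 → deriv S t = 0 := by
    have h1 : ∀ t, t < 0 → deriv S t = 0 := fun t ht => by
      have : S =ᶠ[𝓝 t] fun _ => 0 := by
        filter_upwards [gt_mem_nhds ht] with s hs
        exact Real.smoothTransition.zero_of_nonpos hs.le
      simp [this.deriv_eq]
    intro t ht
    -- The endpoint `0` follows by continuity of `S'`; it corresponds to `|t| = k`, where `ψ'` must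
    -- vanish too.
    have hcl : IsClosed {t | deriv S t = 0} := isClosed_eq hSd' continuous_const
    have := hcl.closure_subset_iff.2 (show Set.Iio (0 : ℝ) ⊆ _ from h1)
    rw [closure_Iio] at this
    exact this ht
  have hS1 : ∀ t, 1 < t → deriv S t = 0 := fun t ht => by
    have : S =ᶠ[𝓝 t] fun _ => 1 := by
      filter_upwards [lt_mem_nhds ht] with s hs
      exact Real.smoothTransition.one_of_one_le hs.le
    simp [this.deriv_eq]
  have hSnn : ∀ t, 0 ≤ deriv S t := fun t => Real.smoothTransition.monotone.deriv_nonneg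
  obtain ⟨L, hL⟩ : ∃ L, ∀ t ∈ Set.Icc (0 : ℝ) 1, ‖deriv S t‖ ≤ L :=
    isCompact_Icc.exists_bound_of_continuousOn hSd'.continuousOn
  have hL' : ∀ t, deriv S t ≤ max L 1 := by
    intro t
    by_cases h0 : t ≤ 0
    · rw [hS0 t h0]; positivity
    by_cases h1 : 1 < t
    · rw [hS1 t h1]; positivity
    · exact (le_abs_self _).trans ((hL t ⟨by linarith, by linarith⟩).trans (le_max_left _ _))
  refine ⟨max L 1, by positivity, fun k δ hk hδ => ?_⟩
  set M := max L 1
  have hM : 0 < M := by positivity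
  -- Height and width both scale by `δ`, so the slope is that of `S`, whatever `k` and `δ` are.
  set ψ : ℝ → ℝ := fun t => δ * S ((t - k) / δ) - δ * S ((-t - k) / δ) with hψ
  have hder : ∀ t, HasDerivAt ψ (deriv S ((t - k) / δ) + deriv S ((-t - k) / δ)) t := by
    intro t
    have h1 : HasDerivAt (fun t : ℝ => (t - k) / δ) (1 / δ) t :=
      ((hasDerivAt_id t).sub_const k).div_const δ
    have h2 : HasDerivAt (fun t : ℝ => (-t - k) / δ) (-1 / δ) t :=
      ((hasDerivAt_id t).neg.sub_const k).div_const δ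
    have h3 := (((hSd _).hasDerivAt.comp t h1).const_mul δ).sub
      (((hSd _).hasDerivAt.comp t h2).const_mul δ)
    have h4 : ∀ a b : ℝ, a + b = δ * (a * (1 / δ)) - δ * (b * (-1 / δ)) := fun a b => by
      field_simp
      ring
    rw [h4]
    exact h3
  have hder' : ∀ t, deriv ψ t = deriv S ((t - k) / δ) + deriv S ((-t - k) / δ) := fun t =>
    (hder t).deriv
  have hz : ∀ t, t ≤ k → S ((t - k) / δ) = 0 ∧ deriv S ((t - k) / δ) = 0 := fun t ht => by
    have : (t - k) / δ ≤ 0 := div_nonpos_of_nonpos_of_nonneg (by linarith) hδ.le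
    exact ⟨Real.smoothTransition.zero_of_nonpos this, hS0 _ this⟩
  have hbig : ∀ t, k + δ < t → deriv S ((t - k) / δ) = 0 := fun t ht =>
    hS1 _ (by rw [lt_div_iff₀ hδ]; linarith)
  have hone : ∀ t, k + δ ≤ t → S ((t - k) / δ) = 1 := fun t ht =>
    Real.smoothTransition.one_of_one_le (by rw [le_div_iff₀ hδ]; linarith)
  have hpos : ∀ t, 0 ≤ t → ψ t = δ * S ((t - k) / δ) ∧ deriv ψ t = deriv S ((t - k) / δ) := by
    intro t ht
    obtain ⟨h1, h2⟩ := hz (-t) (by linarith)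
    exact ⟨by simp only [hψ, h1]; ring, by rw [hder', h2, add_zero]⟩
  have hneg : ∀ t, t ≤ 0 → ψ t = -(δ * S ((-t - k) / δ)) ∧
      deriv ψ t = deriv S ((-t - k) / δ) := by
    intro t ht
    obtain ⟨h1, h2⟩ := hz t (by linarith)
    exact ⟨by simp only [hψ, h1]; ring, by rw [hder', h2, zero_add]⟩
  have habs : ∀ t, |ψ t| = δ * S ((|t| - k) / δ) ∧ deriv ψ t = deriv S ((|t| - k) / δ) := by
    intro t
    rcases le_total 0 t with ht | ht
    · rw [abs_of_nonneg ht, (hpos t ht).1, abs_of_nonneg]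
      · exact ⟨rfl, (hpos t ht).2⟩
      · exact mul_nonneg hδ.le (Real.smoothTransition.nonneg _)
    · rw [abs_of_nonpos ht, (hneg t ht).1, abs_neg, abs_of_nonneg]
      · exact ⟨rfl, (hneg t ht).2⟩
      · exact mul_nonneg hδ.le (Real.smoothTransition.nonneg _)
  have hle : ∀ t, |ψ t| ≤ δ := fun t => by
    rw [(habs t).1]
    exact mul_le_of_le_one_right hδ.le (Real.smoothTransition.le_one _)
  have hdle : ∀ t, deriv ψ t ≤ M := fun t => (habs t).2.trans_le (hL' _)
  have hdnn : ∀ t, 0 ≤ deriv ψ t := fun t => (hSnn _).trans_eq (habs t).2.symm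
  -- This `K` depends on `k` and `δ`, harmlessly: it only justifies integrability and limits. The
  -- term `(k + δ) * M` bounds `t ψ'(t)`, as `ψ'` vanishes for `|t| > k + δ`.
  refine ⟨ψ, δ + M + (k + δ) * M, ⟨?_, ?_, hdnn, fun t => ?_, fun t => ?_, fun t => ?_⟩, hle, hdle,
    fun t ht => ?_, fun t ht => ?_, fun t ht => ?_⟩
  · have h1 : ContDiff ℝ ∞ fun t : ℝ => (t - k) / δ := (contDiff_id.sub contDiff_const).div_const δ
    have h2 : ContDiff ℝ ∞ fun t : ℝ => (-t - k) / δ :=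
      (contDiff_id.neg.sub contDiff_const).div_const δ
    exact (contDiff_const.mul (hSc.comp h1)).sub (contDiff_const.mul (hSc.comp h2))
  · simp [hψ]
  · exact (hle t).trans (by have : 0 ≤ (k + δ) * M := by positivity
                            linarith)
  · rw [abs_of_nonneg (hdnn t)]
    exact (hdle t).trans (by have : 0 ≤ (k + δ) * M := by positivity
                             linarith)
  · rw [abs_mul, abs_of_nonneg (hdnn t)]
    by_cases ht : |t| ≤ k + δ
    · have : |t| * deriv ψ t ≤ (k + δ) * M := mul_le_mul ht (hdle t) (hdnn t) (by linarith)
      linarith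
    · rw [(habs t).2, hbig _ (not_le.1 ht)]
      simp only [mul_zero]
      positivity
  · rw [← abs_eq_zero, (habs t).1, (hz _ ht).1, mul_zero]
  · rw [(habs t).2, (hz _ ht).2]
  · rw [(habs t).1, hone _ ht, mul_one]

/-! ### Decay of the distribution function -/

section Decay

variable {d : ℕ}

/-- Hölder's inequality on `S`. It is used with `S = {|u| > k}`, once for `f` and `ψ(u)`, once for
`‖F‖²` and `ψ'(u)`. -/
lemma integral_norm_mul_abs_le_of_support {X E : Type*} [MeasurableSpace X] [NormedAddCommGroup E]
    {μ : Measure X} [IsFiniteMeasure μ] {f : X → E} {q : ℝ} (hq : 1 ≤ q)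
    (hf : MemLp f (ENNReal.ofReal q) μ) {S : Set X} (hS : NullMeasurableSet S μ) {w : X → ℝ}
    {K : ℝ} (hK : ∀ x, |w x| ≤ K) (hw : ∀ x, x ∉ S → w x = 0) (hK0 : 0 ≤ K) :
    ∫ x, ‖f x‖ * |w x| ∂μ ≤
      K * ((eLpNorm f (ENNReal.ofReal q) μ).toReal * μ.real S ^ (1 - 1 / q)) := by
  have hfi : Integrable f μ := hf.integrable (by simpa using hq)
  calc ∫ x, ‖f x‖ * |w x| ∂μ ≤ ∫ x, S.indicator (fun x => K * ‖f x‖) x ∂μ := by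
        refine integral_mono_of_nonneg (Eventually.of_forall fun x => by
          simp only [Pi.zero_apply]; positivity)
          ((hfi.norm.const_mul K).indicator₀ hS) (Eventually.of_forall fun x => ?_)
        by_cases hx : x ∈ S
        · simp only [Set.indicator_of_mem hx]
          rw [mul_comm]
          exact mul_le_mul_of_nonneg_right (hK x) (norm_nonneg _)
        · simp [Set.indicator_of_notMem hx, hw x hx]
    _ = K * ∫ x in S, ‖f x‖ ∂μ := by rw [integral_indicator₀ hS, integral_const_mul]
    _ ≤ _ := by
      refine mul_le_mul_of_nonneg_left ?_ hK0
      rw [integral_norm_eq_lintegral_enorm hf.1.restrict, ← eLpNorm_one_eq_lintegral_enorm]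
      have h1 := eLpNorm_le_eLpNorm_mul_rpow_measure_univ (μ := μ.restrict S) (f := f)
        (p := 1) (q := ENNReal.ofReal q) (by simpa using hq) hf.1.restrict
      have h2 : eLpNorm f (ENNReal.ofReal q) (μ.restrict S) ≤ eLpNorm f (ENNReal.ofReal q) μ :=
        eLpNorm_mono_measure f Measure.restrict_le_self
      have he : 0 ≤ 1 - 1 / q := by
        rw [sub_nonneg, div_le_one (by linarith)]; exact hq
      rw [Measure.restrict_apply_univ, ENNReal.toReal_ofReal (by linarith)] at h1
      simp only [ENNReal.toReal_one, div_one] at h1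
      have h3 := h1.trans (mul_le_mul_left h2 _)
      have h4 := ENNReal.toReal_mono (ENNReal.mul_ne_top hf.eLpNorm_ne_top
        (ENNReal.rpow_ne_top_of_nonneg he (measure_ne_top μ S))) h3
      rwa [ENNReal.toReal_mul, ← ENNReal.toReal_rpow] at h4

lemma memLp_norm_sq {X E : Type*} [MeasurableSpace X] [NormedAddCommGroup E]
    {μ : Measure X} {F : X → E} {q : ℝ} (hq : 0 < q)
    (hF : MemLp F (ENNReal.ofReal (2 * q)) μ) :
    MemLp (fun x => ‖F x‖ ^ 2) (ENNReal.ofReal q) μ ∧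
      eLpNorm (fun x => ‖F x‖ ^ 2) (ENNReal.ofReal q) μ
        = eLpNorm F (ENNReal.ofReal (2 * q)) μ ^ 2 := by
  have h := eLpNorm_norm_rpow (μ := μ) (p := ENNReal.ofReal q) F (q := 2) (by norm_num)
  have he : ENNReal.ofReal q * ENNReal.ofReal 2 = ENNReal.ofReal (2 * q) := by
    rw [← ENNReal.ofReal_mul hq.le, mul_comm]
  rw [he] at h
  simp only [Real.rpow_ofNat, ENNReal.rpow_ofNat] at h
  refine ⟨⟨(hF.1.norm.pow 2), ?_⟩, h⟩
  rw [h]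
  exact ENNReal.pow_lt_top hF.2

/-- Cauchy-Schwarz for the weight `w`: the quadratic `s ↦ ∫ (g s + 1)² w` is nonnegative, so its
discriminant is not positive. -/
lemma sq_integral_mul_le {X : Type*} [MeasurableSpace X] {μ : Measure X} {g w : X → ℝ}
    (hw : ∀ x, 0 ≤ w x) (h2 : Integrable (fun x => g x ^ 2 * w x) μ)
    (h1 : Integrable (fun x => g x * w x) μ) (h0 : Integrable w μ) :
    (∫ x, g x * w x ∂μ) ^ 2 ≤ (∫ x, g x ^ 2 * w x ∂μ) * ∫ x, w x ∂μ := by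
  have hq : ∀ s : ℝ, 0 ≤ (∫ x, g x ^ 2 * w x ∂μ) * (s * s) + (2 * ∫ x, g x * w x ∂μ) * s
      + ∫ x, w x ∂μ := by
    intro s
    have : (∫ x, g x ^ 2 * w x ∂μ) * (s * s) + (2 * ∫ x, g x * w x ∂μ) * s + ∫ x, w x ∂μ
        = ∫ x, (g x * s + 1) ^ 2 * w x ∂μ := by
      rw [← integral_const_mul, ← integral_mul_const, ← integral_mul_const,
        ← integral_add (h2.mul_const _) ((h1.const_mul 2).mul_const s), ← integral_add
        (f := fun x => g x ^ 2 * w x * (s * s) + 2 * (g x * w x) * s)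
        ((h2.mul_const _).add ((h1.const_mul 2).mul_const s)) h0]
      refine integral_congr_ae (Eventually.of_forall fun x => ?_)
      simp only
      ring
    rw [this]
    exact integral_nonneg fun x => mul_nonneg (sq_nonneg _) (hw x)
  have := discrim_le_zero hq
  rw [discrim] at this
  nlinarith

/-- Decay of the distribution function of a function satisfying the energy inequality. -/
lemma exists_measure_decay (hd : 2 ≤ d) {lam : ℝ} (hlam : 0 < lam) : ∃ C : ℝ, 0 < C ∧
    ∀ (U : Set (EuclideanSpace ℝ (Fin d))) (f u : EuclideanSpace ℝ (Fin d) → ℝ)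
      (F G : EuclideanSpace ℝ (Fin d) → EuclideanSpace ℝ (Fin d))
      (φ : ℕ → EuclideanSpace ℝ (Fin d) → ℝ) (q m k δ : ℝ),
      IsFiniteMeasure (volume.restrict U) → IsTestApproximation U u G φ →
      EnergyInequality lam U f F u G → 1 ≤ q →
      MemLp f (ENNReal.ofReal q) (volume.restrict U) →
      MemLp F (ENNReal.ofReal (2 * q)) (volume.restrict U) →
      (eLpNorm f (ENNReal.ofReal q) (volume.restrict U)).toReal ≤ m →
      (eLpNorm F (ENNReal.ofReal (2 * q)) (volume.restrict U)).toReal ≤ m →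
      0 ≤ k → 0 < δ →
      δ ^ 2 * (volume.restrict U).real {x | k + δ < |u x|} ^ (2 - 2 / (d : ℝ)) ≤
        C * (δ * m + m ^ 2) * (volume.restrict U).real {x | k < |u x|} ^ (2 - 1 / q) := by
  obtain ⟨L, hL, hψ⟩ := exists_smoothTruncation
  have hd' : (2 : ℝ) ≤ d := by exact_mod_cast hd
  set r : ℝ := Real.conjExponent d
  have hr : Real.HolderConjugate d r := Real.HolderConjugate.conjExponent (by linarith)
  have hr0 : 0 < r := hr.symm.pos
  have hrinv : 2 * r⁻¹ = 2 - 2 / (d : ℝ) := by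
    have := hr.inv_add_inv_eq_one
    rw [div_eq_mul_inv]; linarith
  set c := lintegralPowLePowLIntegralFDerivConst (volume : Measure (EuclideanSpace ℝ (Fin d))) r
  set C₁ := 2 / lam * (1 + L / (2 * lam)) with hC₁
  -- The `+ 1` secures positivity without knowing that the Sobolev constant is nonzero.
  refine ⟨(c : ℝ) ^ (2 * r⁻¹) * C₁ * L + 1, by positivity, ?_⟩
  intro U f u F G φ q m k δ hfin ha hen hq hf hF hfm hFm hk hδ
  obtain ⟨ψ, K, hψK, hψδ, hψL, hψ0, hψ'0, hψ1⟩ := hψ k δ hk hδ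
  set μ := volume.restrict U with hμ
  have hm : 0 ≤ m := ENNReal.toReal_nonneg.trans hfm
  have hum := ha.aestronglyMeasurable
  have hS : NullMeasurableSet {x | k < |u x|} μ :=
    nullMeasurableSet_lt aemeasurable_const hum.norm.aemeasurable
  set T := μ.real {x | k < |u x|} with hT
  have hT0 : 0 ≤ T := measureReal_nonneg
  have hψ'm : AEStronglyMeasurable (fun x => deriv ψ (u x)) μ :=
    hψK.continuous_deriv.comp_aestronglyMeasurable hum
  have hF2 : MemLp F 2 μ := hF.mono_exponent (by
    rw [show (2 : ℝ≥0∞) = ENNReal.ofReal 2 by simp]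
    exact ENNReal.ofReal_le_ofReal (by linarith))
  have hfi : Integrable f μ := hf.integrable (by simpa using hq)
  obtain ⟨hFsq, hFsq'⟩ := memLp_norm_sq (by linarith) hF
  have hGi := ha.memLp.integrable_norm_pow (by norm_num : (2 : ℕ) ≠ 0)
  have hGψ : Integrable (fun x => ‖G x‖ ^ 2 * deriv ψ (u x)) μ :=
    hGi.mul_comp_bounded hψK.continuous_deriv hψK.abs_deriv_le hum
  have hFψ : Integrable (fun x => ‖F x‖ ^ 2 * deriv ψ (u x)) μ :=
    (hF2.integrable_norm_pow (by norm_num)).mul_comp_bounded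
      hψK.continuous_deriv hψK.abs_deriv_le hum
  have hG1 : Integrable (fun x => ‖G x‖ * deriv ψ (u x)) μ :=
    ((ha.memLp.integrable (by norm_num)).norm).mul_comp_bounded
      hψK.continuous_deriv hψK.abs_deriv_le hum
  have hψ'i : Integrable (fun x => deriv ψ (u x)) μ := by
    simpa using (integrable_const (1 : ℝ)).mul_comp_bounded (μ := μ) (u := u)
      hψK.continuous_deriv hψK.abs_deriv_le hum
  set P := ∫ x in U, ‖G x‖ ^ 2 * deriv ψ (u x) with hP
  set Q := ∫ x in U, ‖G x‖ * deriv ψ (u x) with hQ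
  have hP0 : 0 ≤ P := integral_nonneg fun x => mul_nonneg (by positivity) (hψK.deriv_nonneg _)
  have hQ0 : 0 ≤ Q := integral_nonneg fun x => mul_nonneg (by positivity) (hψK.deriv_nonneg _)
  have hfb : ∫ x in U, f x * ψ (u x) ≤ δ * (m * T ^ (1 - 1 / q)) := by
    calc ∫ x in U, f x * ψ (u x) ≤ ∫ x in U, ‖f x‖ * |ψ (u x)| := by
          refine integral_mono
            (hfi.mul_comp_bounded hψK.smooth.continuous hψK.abs_le hum)
            (hfi.norm.mul_comp_bounded (g := fun t => |ψ t|) hψK.smooth.continuous.abs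
              (by simpa using hψK.abs_le) hum) fun x => ?_
          simp only [Real.norm_eq_abs]
          rw [← abs_mul]
          exact le_abs_self _
      _ ≤ δ * ((eLpNorm f (ENNReal.ofReal q) μ).toReal * T ^ (1 - 1 / q)) :=
          integral_norm_mul_abs_le_of_support hq hf hS (fun x => hψδ _)
            (fun x hx => hψ0 _ (not_lt.1 hx)) hδ.le
      _ ≤ _ := by gcongr
  have hFb : ∫ x in U, ‖F x‖ ^ 2 * deriv ψ (u x) ≤ L * (m ^ 2 * T ^ (1 - 1 / q)) := by
    have h1 := integral_norm_mul_abs_le_of_support hq hFsq hS (w := fun x => deriv ψ (u x))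
      (fun x => (abs_of_nonneg (hψK.deriv_nonneg _)).trans_le (hψL _))
      (fun x hx => hψ'0 _ (not_lt.1 hx)) hL.le
    simp only [norm_pow, norm_norm, abs_of_nonneg (hψK.deriv_nonneg _)] at h1
    rw [hFsq', ENNReal.toReal_pow] at h1
    refine h1.trans ?_
    gcongr
  -- Young's inequality is weighted so that `lam / 2 * P` is absorbed by the left side of the energy
  -- inequality; this produces `C₁`.
  have hyoung : ∫ x in U, inner ℝ (F x) (G x) * deriv ψ (u x) ≤
      1 / (2 * lam) * (∫ x in U, ‖F x‖ ^ 2 * deriv ψ (u x)) + lam / 2 * P := by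
    rw [hP, ← integral_const_mul, ← integral_const_mul,
      ← integral_add (hFψ.const_mul _) (hGψ.const_mul _)]
    refine integral_mono ((hF2.integrable_inner_of_two ha.memLp).mul_comp_bounded
      hψK.continuous_deriv hψK.abs_deriv_le hum) ((hFψ.const_mul _).add (hGψ.const_mul _))
      fun x => ?_
    simp only
    rw [← mul_assoc, ← mul_assoc, ← add_mul]
    refine mul_le_mul_of_nonneg_right ((real_inner_le_norm _ _).trans ?_) (hψK.deriv_nonneg _)
    have : 1 / (2 * lam) * ‖F x‖ ^ 2 + lam / 2 * ‖G x‖ ^ 2 - ‖F x‖ * ‖G x‖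
        = 1 / (2 * lam) * (‖F x‖ - lam * ‖G x‖) ^ 2 := by
      field_simp
      ring
    have h' : 0 ≤ 1 / (2 * lam) * (‖F x‖ - lam * ‖G x‖) ^ 2 := by positivity
    linarith
  have hPb : P ≤ C₁ * (δ * m + m ^ 2) * T ^ (1 - 1 / q) := by
    have h1 := hen ψ K hψK
    set Y := T ^ (1 - 1 / q)
    have hY : 0 ≤ Y := by positivity
    have h2 : 1 / (2 * lam) * (∫ x in U, ‖F x‖ ^ 2 * deriv ψ (u x)) ≤
        1 / (2 * lam) * (L * (m ^ 2 * Y)) := by gcongr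
    have h3 : lam / 2 * P ≤ δ * (m * Y) + 1 / (2 * lam) * (L * (m ^ 2 * Y)) := by linarith
    have h4 : P ≤ 2 / lam * (δ * (m * Y) + 1 / (2 * lam) * (L * (m ^ 2 * Y))) := by
      calc P = 2 / lam * (lam / 2 * P) := by field_simp
        _ ≤ _ := by gcongr
    refine h4.trans (le_of_sub_nonneg ?_)
    have : C₁ * (δ * m + m ^ 2) * Y
        - 2 / lam * (δ * (m * Y) + 1 / (2 * lam) * (L * (m ^ 2 * Y)))
        = 2 / lam * (m ^ 2 * Y + L / (2 * lam) * (δ * m * Y)) := by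
      rw [hC₁]; ring
    rw [this]
    positivity
  have hR : ∫ x in U, deriv ψ (u x) ≤ L * T := by
    calc ∫ x in U, deriv ψ (u x) ≤ ∫ x in U, {x | k < |u x|}.indicator (fun _ => L) x := by
          refine integral_mono hψ'i ((integrable_const L).indicator₀ hS) fun x => ?_
          by_cases hx : x ∈ {x | k < |u x|}
          · simp only [Set.indicator_of_mem hx]
            exact hψL _
          · simp only [Set.indicator_of_notMem hx]
            exact (hψ'0 _ (not_lt.1 hx)).le
      _ = L * T := by
          rw [integral_indicator₀ hS, setIntegral_const, smul_eq_mul, mul_comm]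
  -- The weight `ψ'(u)` lives on `{|u| > k}`, which gains the extra factor `T`.
  have hQP : Q ^ 2 ≤ P * (L * T) :=
    (sq_integral_mul_le (fun x => hψK.deriv_nonneg _) hGψ hG1 hψ'i).trans
      (mul_le_mul_of_nonneg_left hR hP0)
  set T' := μ.real {x | k + δ < |u x|} with hT'
  have hT'0 : 0 ≤ T' := measureReal_nonneg
  -- Chebyshev, as `|ψ(u)| = δ` on `{|u| > k + δ}`, combined with the Sobolev inequality.
  have hgns : δ ^ r * T' ≤ c * Q ^ r := by
    have h1 := ha.lintegral_rpow_le hψK.smooth hψK.zero hψK.abs_deriv_le hr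
    simp only [abs_of_nonneg (hψK.deriv_nonneg _)] at h1
    have h2 : ENNReal.ofReal δ ^ r * μ {x | k + δ < |u x|} ≤ ∫⁻ x in U, ‖ψ (u x)‖ₑ ^ r := by
      have hm1 : AEMeasurable (fun x => ‖ψ (u x)‖ₑ ^ r) μ :=
        (hψK.smooth.continuous.comp_aestronglyMeasurable hum).enorm.pow_const r
      refine le_trans ?_ (mul_meas_ge_le_lintegral₀ hm1 (ENNReal.ofReal δ ^ r))
      gcongr
      intro hx
      refine ENNReal.rpow_le_rpow ?_ hr0.le
      rw [← ofReal_norm, Real.norm_eq_abs, hψ1 _ (le_of_lt hx)]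
    have h3 := ENNReal.toReal_mono (ENNReal.mul_ne_top ENNReal.coe_ne_top
      (ENNReal.rpow_ne_top_of_nonneg hr0.le ENNReal.ofReal_ne_top)) (h2.trans h1)
    rwa [ENNReal.toReal_mul, ENNReal.toReal_mul, ← ENNReal.toReal_rpow, ← ENNReal.toReal_rpow,
      ENNReal.toReal_ofReal hδ.le, ENNReal.toReal_ofReal hQ0, ENNReal.coe_toReal] at h3
  have hgns' : δ ^ 2 * T' ^ (2 * r⁻¹) ≤ (c : ℝ) ^ (2 * r⁻¹) * Q ^ 2 := by
    have h1 := Real.rpow_le_rpow (by positivity) hgns (show 0 ≤ 2 * r⁻¹ by positivity)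
    have h2 : ∀ s : ℝ, 0 ≤ s → (s ^ r) ^ (2 * r⁻¹) = s ^ 2 := fun s hs => by
      rw [← Real.rpow_mul hs, show r * (2 * r⁻¹) = 2 by field_simp, Real.rpow_ofNat]
    rwa [Real.mul_rpow (by positivity) hT'0, Real.mul_rpow (by positivity) (by positivity),
      h2 _ hδ.le, h2 _ hQ0] at h1
  have hexp : T ^ (1 - 1 / q) * T = T ^ (2 - 1 / q) := by
    have he : 0 ≤ 1 - 1 / q := by
      rw [sub_nonneg, div_le_one (by linarith)]; exact hq
    rw [show 2 - 1 / q = (1 - 1 / q) + 1 by ring, Real.rpow_add_of_nonneg hT0 he zero_le_one,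
      Real.rpow_one]
  rw [← hrinv]
  calc δ ^ 2 * T' ^ (2 * r⁻¹) ≤ (c : ℝ) ^ (2 * r⁻¹) * Q ^ 2 := hgns'
    _ ≤ (c : ℝ) ^ (2 * r⁻¹) * (C₁ * (δ * m + m ^ 2) * T ^ (1 - 1 / q) * (L * T)) := by
        gcongr
        exact hQP.trans (by gcongr)
    _ = (c : ℝ) ^ (2 * r⁻¹) * C₁ * L * (δ * m + m ^ 2) * T ^ (2 - 1 / q) := by
        rw [← hexp]; ring
    _ ≤ _ := by
        gcongr
        linarith

end Decay

/-! ### Iteration over levels -/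

/-- Stampacchia's lemma, in the form adapted to the decay estimate. -/
lemma exists_level_eq_zero {a b C V : ℝ} (ha : 0 < a) (hab : a < b) (hC : 0 < C) (hV : 0 ≤ V) :
    ∃ L : ℝ, 0 < L ∧ ∀ (T : ℝ → ℝ) (m : ℝ), 0 < m → Antitone T → (∀ k, 0 ≤ T k) →
      (∀ k, T k ≤ V) →
      (∀ k δ, 0 ≤ k → 0 < δ → δ ^ 2 * T (k + δ) ^ a ≤ C * (δ * m + m ^ 2) * T k ^ b) →
      T (L * m) = 0 := by
  have hba : 0 < b - a := sub_pos.2 hab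
  -- Chosen so that `r ^ (b - a) = 1/4`, which compensates the factor `1/4` lost in `δ²` each time
  -- the increment is halved.
  set r : ℝ := (4 : ℝ) ^ (-(b - a)⁻¹) with hr
  have hr0 : 0 < r := by positivity
  have hr1 : r < 1 := Real.rpow_lt_one_of_one_lt_of_neg (by norm_num) (by simpa using hba)
  have hrba : r ^ (b - a) = 4⁻¹ := by
    rw [hr, ← Real.rpow_mul (by norm_num), show -(b - a)⁻¹ * (b - a) = -1 by field_simp,
      Real.rpow_neg_one]
  -- The second entry closes the induction `T (κ n) ≤ V * r ^ n`: its `8` is `2` from merging the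
  -- two data terms times `4` from `δ²`. The entry `1` gives `m² ≤ L m²` in that merging.
  set L : ℝ := max 1 (8 * C * V ^ (b - a) / r ^ a) with hL
  have hL1 : 1 ≤ L := le_max_left _ _
  have hL2 : 8 * C * V ^ (b - a) ≤ L * r ^ a := by
    rw [← div_le_iff₀ (by positivity)]; exact le_max_right _ _
  refine ⟨L, by linarith, fun T m hm hanti hT0 hTV hdec => ?_⟩
  set κ : ℕ → ℝ := fun n => L * m * (1 - (1 / 2) ^ n) with hκ
  have hκ0 : ∀ n, 0 ≤ κ n := fun n => by
    have : ((1 : ℝ) / 2) ^ n ≤ 1 := pow_le_one₀ (by norm_num) (by norm_num)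
    have : (0 : ℝ) ≤ 1 - (1 / 2) ^ n := by linarith
    positivity
  have hκs : ∀ n, κ (n + 1) = κ n + L * m * (1 / 2) ^ (n + 1) := fun n => by
    simp only [hκ, pow_succ]; ring
  have hκL : ∀ n, κ n ≤ L * m := fun n => by
    have : (0 : ℝ) < (1 / 2) ^ n := by positivity
    have : 0 ≤ L * m * (1 / 2) ^ n := by positivity
    simp only [hκ]; linarith
  have hbound : ∀ n : ℕ, T (κ n) ≤ V * r ^ n := by
    intro n
    induction n with
    | zero => simpa using hTV _
    | succ n ih =>
      set δ := L * m * (1 / 2) ^ (n + 1) with hδ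
      have hδ0 : 0 < δ := by positivity
      have hδL : δ ≤ L * m := by
        have : ((1 : ℝ) / 2) ^ (n + 1) ≤ 1 := pow_le_one₀ (by norm_num) (by norm_num)
        exact mul_le_of_le_one_right (by positivity) this
      have h1 := hdec (κ n) δ (hκ0 n) hδ0
      rw [← hκs] at h1
      have h2 : δ ^ 2 * T (κ (n + 1)) ^ a ≤ δ ^ 2 * (V * r ^ (n + 1)) ^ a := by
        calc δ ^ 2 * T (κ (n + 1)) ^ a ≤ C * (δ * m + m ^ 2) * T (κ n) ^ b := h1
          _ ≤ C * (L * m * m + L * m ^ 2) * (V * r ^ n) ^ b := by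
              have : m ^ 2 ≤ L * m ^ 2 := le_mul_of_one_le_left (by positivity) hL1
              have hTn := hT0 (κ n)
              have hb : 0 ≤ b := by linarith
              gcongr
          _ = m ^ 2 * L * (1 / 4) ^ (n + 1) * (8 * C * V ^ (b - a)) * V ^ a * (r ^ n) ^ a := by
              have e1 : V ^ b = V ^ (b - a) * V ^ a := by
                rw [← Real.rpow_add_of_nonneg hV hba.le ha.le, sub_add_cancel]
              have e2 : (r ^ n) ^ b = (1 / 4) ^ n * (r ^ n) ^ a := by
                have e3 : (r ^ n) ^ (b - a) = (1 / 4) ^ n := by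
                  rw [← Real.rpow_natCast r n, ← Real.rpow_mul hr0.le, mul_comm,
                    Real.rpow_mul hr0.le, hrba, Real.rpow_natCast, one_div]
                rw [← e3, ← Real.rpow_add (by positivity), sub_add_cancel]
              rw [Real.mul_rpow hV (by positivity), e1, e2]
              ring
          _ ≤ m ^ 2 * L * (1 / 4) ^ (n + 1) * (L * r ^ a) * V ^ a * (r ^ n) ^ a := by gcongr
          _ = δ ^ 2 * (V * r ^ (n + 1)) ^ a := by
              rw [Real.mul_rpow hV (by positivity), pow_succ r,
                Real.mul_rpow (by positivity) hr0.le, hδ, mul_pow, mul_pow, ← pow_mul,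
                mul_comm (n + 1) 2, pow_mul]
              norm_num
              ring
      have h3 := le_of_mul_le_mul_left h2 (by positivity)
      exact (Real.rpow_le_rpow_iff (hT0 _) (by positivity) ha).1 h3
  have hlim : Tendsto (fun n : ℕ => V * r ^ n) atTop (𝓝 0) := by
    simpa using (tendsto_pow_atTop_nhds_zero_of_lt_one hr0.le hr1).const_mul V
  exact le_antisymm (ge_of_tendsto' hlim fun n => (hanti (hκL n)).trans (hbound n)) (hT0 _)

/-! ### The supremum bound and the theorem -/

/-- A function of `H^{1,2}_0(U)` satisfying the energy inequality is bounded by the data. -/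
lemma exists_eLpNorm_top_le {d : ℕ} (hd : 2 ≤ d) {lam : ℝ} (hlam : 0 < lam) {q : ℝ}
    (hq : (d : ℝ) / 2 < q) (V : ℝ≥0) : ∃ C : ℝ, 0 < C ∧
    ∀ (U : Set (EuclideanSpace ℝ (Fin d))) (f u : EuclideanSpace ℝ (Fin d) → ℝ)
      (F G : EuclideanSpace ℝ (Fin d) → EuclideanSpace ℝ (Fin d)),
      volume U = V → MemSobolevZero U u G → EnergyInequality lam U f F u G →
      MemLp f (ENNReal.ofReal q) (volume.restrict U) →
      MemLp F (ENNReal.ofReal (2 * q)) (volume.restrict U) →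
      eLpNorm u ∞ (volume.restrict U) ≤ ENNReal.ofReal C *
        (eLpNorm f (ENNReal.ofReal q) (volume.restrict U)
          + eLpNorm F (ENNReal.ofReal (2 * q)) (volume.restrict U)) := by
  have hd' : (2 : ℝ) ≤ d := by exact_mod_cast hd
  have hq1 : 1 ≤ q := by linarith
  obtain ⟨C, hC, hdecay⟩ := exists_measure_decay hd hlam
  have ha : 0 < 2 - 2 / (d : ℝ) := by
    have : 2 / (d : ℝ) ≤ 1 := (div_le_one (by linarith)).2 hd'
    linarith
  have hab : 2 - 2 / (d : ℝ) < 2 - 1 / q := by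
    have : 1 / q < 2 / (d : ℝ) := by
      rw [div_lt_div_iff₀ (by linarith) (by linarith)]; linarith
    linarith
  obtain ⟨L, hL, hlevel⟩ := exists_level_eq_zero ha hab hC V.coe_nonneg
  refine ⟨L, hL, fun U f u F G hU hu hen hf hF => ?_⟩
  have hfin : IsFiniteMeasure (volume.restrict U) :=
    isFiniteMeasure_restrict.2 (by rw [hU]; exact ENNReal.coe_ne_top)
  obtain ⟨φ, hφ⟩ := hu.exists_testApproximation
  set Nf := eLpNorm f (ENNReal.ofReal q) (volume.restrict U)
  set NF := eLpNorm F (ENNReal.ofReal (2 * q)) (volume.restrict U)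
  -- The iteration needs a positive size `m` of the data; `ε` covers vanishing `f` and `F` and is
  -- sent to `0` afterwards.
  have hbound : ∀ ε : ℝ, 0 < ε →
      eLpNorm u ∞ (volume.restrict U) ≤ ENNReal.ofReal (L * ((Nf.toReal + NF.toReal) + ε)) := by
    intro ε hε
    have hNf : 0 ≤ Nf.toReal := ENNReal.toReal_nonneg
    have hNF : 0 ≤ NF.toReal := ENNReal.toReal_nonneg
    have hz := hlevel (fun k => (volume.restrict U).real {x | k < |u x|})
      (Nf.toReal + NF.toReal + ε) (by positivity)
      (fun k l hkl => measureReal_mono fun x hx => lt_of_le_of_lt hkl hx)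
      (fun k => measureReal_nonneg)
      (fun k => by
        refine (measureReal_mono (Set.subset_univ _)).trans_eq ?_
        simp [measureReal_def, hU])
      (fun k δ hk hδ => hdecay U f u F G φ q _ k δ hfin hφ hen hq1 hf hF
        (by linarith) (by linarith) hk hδ)
    rw [measureReal_eq_zero_iff] at hz
    rw [eLpNorm_exponent_top]
    refine eLpNormEssSup_le_of_ae_bound ?_
    rw [ae_iff]
    simpa only [not_le, Real.norm_eq_abs] using hz
  have hlim : Tendsto (fun ε : ℝ => ENNReal.ofReal (L * ((Nf.toReal + NF.toReal) + ε))) (𝓝[>] 0)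
      (𝓝 (ENNReal.ofReal (L * ((Nf.toReal + NF.toReal) + 0)))) := by
    refine (ENNReal.continuous_ofReal.comp (by fun_prop)).continuousWithinAt.tendsto
  refine (ge_of_tendsto hlim (eventually_mem_nhdsWithin.mono hbound)).trans_eq ?_
  rw [add_zero, ENNReal.ofReal_mul hL.le, ENNReal.ofReal_add ENNReal.toReal_nonneg
    ENNReal.toReal_nonneg, ENNReal.ofReal_toReal hf.eLpNorm_ne_top,
    ENNReal.ofReal_toReal hF.eLpNorm_ne_top]

theorem theorem4p2 (d : ℕ) (hd : 2 ≤ d) (lam : ℝ) (hlam : 0 < lam) (q : ℝ)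
    (hq : (d : ℝ) / 2 < q) (V : ℝ≥0) :
    ∃ C : ℝ, 0 < C ∧
      ∀ (p : ℝ) (U : Set (EuclideanSpace ℝ (Fin d)))
        (A : EuclideanSpace ℝ (Fin d) → Matrix (Fin d) (Fin d) ℝ)
        (B : EuclideanSpace ℝ (Fin d) → EuclideanSpace ℝ (Fin d))
        (c : EuclideanSpace ℝ (Fin d) → ℝ) (α : ℝ)
        (f : EuclideanSpace ℝ (Fin d) → ℝ)
        (F : EuclideanSpace ℝ (Fin d) → EuclideanSpace ℝ (Fin d)),
        AssumptionA lam p U A B c α → volume U = (V : ℝ≥0∞) → p ≤ q →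
        MemLp f (ENNReal.ofReal q) (volume.restrict U) →
        MemLp F (ENNReal.ofReal (2 * q)) (volume.restrict U) →
        (∀ u : EuclideanSpace ℝ (Fin d) → ℝ, MemLp u ∞ (volume.restrict U) →
          IsWeakSolution U A B c α f F u →
          eLpNorm u ∞ (volume.restrict U) ≤ ENNReal.ofReal C *
            (eLpNorm f (ENNReal.ofReal q) (volume.restrict U)
              + eLpNorm F (ENNReal.ofReal (2 * q)) (volume.restrict U))) ∧
        (∀ w : EuclideanSpace ℝ (Fin d) → ℝ, MemLp w ∞ (volume.restrict U) →
          IsWeakSolutionDual U A B c α f F w →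
          eLpNorm w ∞ (volume.restrict U) ≤ ENNReal.ofReal C *
            (eLpNorm f (ENNReal.ofReal q) (volume.restrict U)
              + eLpNorm F (ENNReal.ofReal (2 * q)) (volume.restrict U))) := by
  obtain ⟨C, hC, hbound⟩ := exists_eLpNorm_top_le hd hlam hq V
  refine ⟨C, hC, fun p U A B c α f F h hU _ hf hF => ?_⟩
  have hd' : (2 : ℝ) ≤ d := by exact_mod_cast hd
  have hq1 : 1 ≤ q := by linarith
  have := h.isFiniteMeasure
  have hfi : IntegrableOn f U := hf.integrable (by simpa using hq1)
  have hF2 : MemLp F 2 (volume.restrict U) := hF.mono_exponent (by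
    rw [show (2 : ℝ≥0∞) = ENNReal.ofReal 2 by simp]
    exact ENNReal.ofReal_le_ofReal (by linarith))
  refine ⟨fun u hu hsol => ?_, fun w hw hsol => ?_⟩
  · obtain ⟨G, hG, hen⟩ := h.energyInequality hfi hF2 hu hsol
    exact hbound U f u F G hU hG hen hf hF
  · obtain ⟨G, hG, hen⟩ := h.energyInequality_dual hfi hF2 hw hsol
    exact hbound U f w F G hU hG hen hf hF
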